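/- All graphs are finite, simple and undirected. For a graph $G$ and a set $S\subseteq V(G)$, the Steiner distance $d_G(S)$ is the minimum number of edges of a connected subgraph of $G$ whose vertex set contains $S$, with $d_G(S)=\infty$ if there is no such subgraph. The Steiner $3$-eccentricity of a vertex $v$ is the maximum of $d_G(S)$ over all $S\subseteq V(G)$ with $|S|=3$ and $v\in S$, and the Steiner $3$-diameter $\mathrm{sdiam}_3(G)$ is the maximum Steiner $3$-eccentricity of a vertex of $G$. Let $e_3(n,\ell,d)$ be the minimum number of edges of a graph $G$ of order $n$ with maximum degree exactly $\ell$ and $\mathrm{sdiam}_3(G)\le d$, with $e_3(n,\ell,d)=\infty$ if there is no such graph. **Theorem.** (1) For $n\ge 5$, $$e_3(n,2,n-3)=\begin{cases}\infty & \text{if } n=5,6,\\ n & \text{if } n\ge 7.\end{cases}$$ (2) For $n\ge 5$, $$e_3(n,3,n-3)=\begin{cases}\infty & \text{if } n=5,\\ n+1 & \text{if } n=6,7,\\ n-1 & \text{if } n\ge 8.\end{cases}$$ (3) For $n\ge 5$, $$e_3(n,4,n-3)=\begin{cases}\binom n2-2 & \text{if } n=5,\\ n+1 & \text{if } n=6,\\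 n-1 & \text{if } n\ge 7.\end{cases}$$ (4) For $n\ge 6$ and $5\le \ell\le n-1$, $e_3(n,\ell,n-3)=n-1$. -/

import Mathlib

/-- Steiner distance of `S` in `G`: the minimum size (number of edges) of a connected subgraph of
`G` whose vertex set contains `S`; it is `⊤` (infinity) when there is no such subgraph. -/
noncomputable def steinerDist {V : Type*} (G : SimpleGraph V) (S : Set V) : ℕ∞ :=
  ⨅ (H : G.Subgraph) (_ : H.Connected ∧ S ⊆ H.verts), H.edgeSet.encard

/-- Steiner `k`-eccentricity of `v`: the maximum Steiner distance of a `k`-element set of vertices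
containing `v`. -/
noncomputable def steinerEcc {V : Type*} (G : SimpleGraph V) (k : ℕ) (v : V) : ℕ∞ :=
  ⨆ (S : Finset V) (_ : S.card = k ∧ v ∈ S), steinerDist G (S : Set V)

/-- Steiner `k`-diameter: the maximum Steiner `k`-eccentricity of a vertex. -/
noncomputable def steinerDiam {V : Type*} (G : SimpleGraph V) (k : ℕ) : ℕ∞ :=
  ⨆ v : V, steinerEcc G k v

open Classical in
/-- The graphs of order `n` (on the vertex set `Fin n`, which represents every graph of order `n`
up to isomorphism) with maximum degree exactly `l` and Steiner `k`-diameter at most `d`. -/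
def steinerFamily (k n l d : ℕ) : Set (SimpleGraph (Fin n)) :=
  {G | G.maxDegree = l ∧ steinerDiam G k ≤ (d : ℕ∞)}

/-- `e_k(n, l, d)`: the minimum size of a graph in `steinerFamily k n l d`; it is `⊤` (infinity)
when that family is empty. -/
noncomputable def minSteinerSize (k n l d : ℕ) : ℕ∞ :=
  ⨅ G ∈ steinerFamily k n l d, G.edgeSet.encard

/-!
A connected vertex set with `m` vertices spans a tree with `m - 1` edges, so the Steiner distance of
`S` is at most `k` exactly if `S` lies in a connected vertex set of size at most `k + 1`
(`steinerDist_le_iff`). For `d = n - 3` this means that every `3`-set of vertices is avoided by a pair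
`{a, b}` whose removal leaves the graph connected (`exists_pair_of_steinerDiam_le`,
`steinerDiam_le_of_pairs`). Such a graph is connected, hence has at least `n - 1` edges.

*Lower bounds beyond `n - 1`.* The graph left after removing `a` and `b` has at least `n - 3` edges,
so `deg a + deg b` is at most `e - n + 3`, plus one if `a` and `b` are adjacent
(`exists_low_degree_pair`). If `e = n - 1`, such a pair contains a leaf; a `3`-set containing all
leaves shows that there are at least four leaves, which excludes maximum degree `2`. If `e = n`, a
pair without leaves consists of adjacent vertices of degree `2`; when there are few of those and few
leaves, one `3`-set meets all pairs (`unicyclic_few_leaves_false`). For `n = 6` and maximum degree at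
most `4`, and for `n = 7` and maximum degree `3`, the degree sum leaves only degree sequences that
are excluded in one of these ways, so `e ≥ n + 1` (`seven_le_edges`, `eight_le_edges`). A graph of
maximum degree `2` on six vertices cannot have seven edges, so none exists there. For `n = 5` every
`3`-set has to be connected, i.e. the complement is a matching (`five_vertices`).

*Upper bounds.* In a tree with five leaves two of the leaves avoid any given `3`-set. Brooms, and
trees with two or three branch vertices for maximum degree `4` and `3`, have this property
(`parentGraph_steinerDiam_le`). For maximum degree `2` the cycle is extremal: for `n ≥ 7` every
`3`-set misses two consecutive vertices. The remaining cases `n ≤ 7` are explicit graphs.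
-/

/-! ### Steiner distance through connected vertex sets -/

/-- A vertex set is connected once each of its vertices other than a root `r` has a neighbour in the
set which is smaller for some rank function. -/
theorem induce_connected_of_rank {V : Type*} {G : SimpleGraph V} {W : Set V} {r : V} (hr : r ∈ W)
    (rank : V → ℕ) (h : ∀ v ∈ W, v ≠ r → ∃ u ∈ W, G.Adj u v ∧ rank u < rank v) :
    (G.induce W).Connected := by
  rw [SimpleGraph.connected_iff_exists_forall_reachable]
  refine ⟨⟨r, hr⟩, ?_⟩
  suffices ∀ m v, ∀ hv : v ∈ W, rank v = m → (G.induce W).Reachable ⟨r, hr⟩ ⟨v, hv⟩ from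
    fun ⟨v, hv⟩ => this _ v hv rfl
  intro m
  induction m using Nat.strong_induction_on with | _ m ih =>
  intro v hv hm
  by_cases hvr : v = r
  · subst hvr
    exact SimpleGraph.Reachable.refl _
  · obtain ⟨u, hu, huv, hlt⟩ := h v hv hvr
    have hadj : (G.induce W).Adj ⟨u, hu⟩ ⟨v, hv⟩ := huv
    exact (ih _ (hm ▸ hlt) u hu rfl).trans hadj.reachable

/-- A connected vertex set of size `m` spans a connected subgraph with `m - 1` edges, and a connected
subgraph with `k` edges has at most `k + 1` vertices. -/
theorem steinerDist_le_iff {V : Type*} [Fintype V] (G : SimpleGraph V) (S : Set V) (k : ℕ) :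
    steinerDist G S ≤ (k : ℕ∞) ↔
      ∃ W : Finset V, S ⊆ W ∧ (G.induce (W : Set V)).Connected ∧ W.card ≤ k + 1 := by
  classical
  constructor
  · intro h
    have : ∃ H : G.Subgraph, (H.Connected ∧ S ⊆ H.verts) ∧ H.edgeSet.encard ≤ k := by
      by_contra! hne
      have : ((k + 1 : ℕ) : ℕ∞) ≤ steinerDist G S := by
        refine le_iInf₂ fun H hH => ?_
        have := hne H hH
        push_cast
        exact Order.add_one_le_of_lt this
      have := this.trans h
      norm_cast at this
      omega
    obtain ⟨H, ⟨hc, hS⟩, hk⟩ := this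
    refine ⟨H.verts.toFinset, by simpa using hS, by rw [Set.coe_toFinset]; exact hc.induce_verts, ?_⟩
    have h1 := hc.coe.card_vert_le_card_edgeSet_add_one
    have h2 : Nat.card H.coe.edgeSet ≤ k := by
      rw [Nat.card_coe_set_eq]
      have : H.coe.edgeSet.encard ≤ k := by
        refine le_trans ?_ hk
        rw [← (Sym2.map.injective Subtype.val_injective).encard_image H.coe.edgeSet]
        apply Set.encard_le_encard
        rintro _ ⟨e, he, rfl⟩
        induction e with | _ x y => simpa using he
      rw [← Set.Finite.cast_ncard_eq (Set.toFinite _)] at this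
      exact_mod_cast this
    rw [Set.toFinset_card, ← Nat.card_eq_fintype_card]
    omega
  · rintro ⟨W, hS, hc, hW⟩
    obtain ⟨T, hT, htree⟩ := hc.exists_isTree_le
    let H : G.Subgraph :=
      { verts := W
        Adj := fun x y => ∃ (hx : x ∈ W) (hy : y ∈ W), T.Adj ⟨x, hx⟩ ⟨y, hy⟩
        adj_sub := by
          rintro x y ⟨hx, hy, h⟩
          exact hT h
        edge_vert := by
          rintro x y ⟨hx, hy, h⟩
          exact hx
        symm := by
          constructor
          rintro x y ⟨hx, hy, h⟩
          exact ⟨hy, hx, h.symm⟩ }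
    have hH : H.coe = T := by
      ext ⟨x, hx⟩ ⟨y, hy⟩
      simp only [SimpleGraph.Subgraph.coe_adj, H]
      exact ⟨fun ⟨_, _, h⟩ => h, fun h => ⟨hx, hy, h⟩⟩
    have hcon : H.Connected := ⟨by rw [hH]; exact htree.connected⟩
    refine (iInf₂_le H ⟨hcon, hS⟩).trans ?_
    have h1 : H.edgeSet ⊆ Sym2.map Subtype.val '' T.edgeSet := by
      intro e he
      induction e with | _ x y =>
        obtain ⟨hx, hy, h⟩ := he
        exact ⟨s(⟨x, hx⟩, ⟨y, hy⟩), h, rfl⟩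
    refine (Set.encard_le_encard h1).trans ((Set.encard_image_le _ _).trans ?_)
    have h2 := htree.card_edgeFinset
    rw [← SimpleGraph.coe_edgeFinset, Set.encard_coe_eq_coe_finsetCard]
    simp at h2
    norm_cast
    omega

theorem steinerDiam_le_iff {V : Type*} (G : SimpleGraph V) (k : ℕ) (hk : k ≠ 0) (d : ℕ∞) :
    steinerDiam G k ≤ d ↔ ∀ S : Finset V, S.card = k → steinerDist G S ≤ d := by
  simp only [steinerDiam, steinerEcc, iSup_le_iff]
  constructor
  · intro h S hS
    obtain ⟨v, hv⟩ := Finset.card_pos.1 (by omega : 0 < S.card)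
    exact h v S ⟨hS, hv⟩
  · rintro h v S ⟨hS, -⟩
    exact h S hS

open Classical in
theorem maxDegree_eq_iff {V : Type*} [Fintype V] [Nonempty V] (G : SimpleGraph V) (l : ℕ) :
    G.maxDegree = l ↔ (∀ v, G.degree v ≤ l) ∧ ∃ v, G.degree v = l := by
  constructor
  · rintro rfl
    exact ⟨G.degree_le_maxDegree, by
      obtain ⟨v, hv⟩ := G.exists_maximal_degree_vertex
      exact ⟨v, hv.symm⟩⟩
  · rintro ⟨h, v, rfl⟩
    exact le_antisymm (G.maxDegree_le_of_forall_degree_le _ h) (G.degree_le_maxDegree v)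

/-- A connected vertex set other than the whole of a connected graph can be enlarged one vertex at
a time. -/
theorem exists_connected_superset_card {V : Type*} [Fintype V] {G : SimpleGraph V}
    (hG : G.Connected) (W : Finset V) (hW : (G.induce (W : Set V)).Connected) (m : ℕ)
    (h1 : W.card ≤ m) (h2 : m ≤ Fintype.card V) :
    ∃ U : Finset V, W ⊆ U ∧ (G.induce (U : Set V)).Connected ∧ U.card = m := by
  classical
  induction m, h1 using Nat.le_induction with
  | base => exact ⟨W, subset_rfl, hW, rfl⟩
  | succ m hm ih =>
    obtain ⟨U, hWU, hU, hcard⟩ := ih (by omega)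
    obtain ⟨y, hy⟩ : ∃ y, y ∉ U := by
      by_contra! h
      rw [Finset.eq_univ_iff_forall.2 h, Finset.card_univ] at hcard
      omega
    obtain ⟨⟨x, hx⟩⟩ := hU.nonempty
    obtain ⟨p⟩ := hG.preconnected x y
    obtain ⟨d, -, hd1, hd2⟩ := p.exists_boundary_dart (U : Set V) hx hy
    refine ⟨insert d.snd U, hWU.trans (Finset.subset_insert _ _), ?_, ?_⟩
    · have := SimpleGraph.connected_induce_union (G := G) (s := (U : Set V)) (t := {d.snd})
        (v := d.fst) (w := d.snd) hU.preconnected SimpleGraph.Preconnected.of_subsingleton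
        hd1 rfl d.adj
      rw [Finset.coe_insert, Set.insert_eq, Set.union_comm]
      exact this
    · rw [Finset.card_insert_of_notMem (by simpa using hd2), hcard]

theorem connected_of_steinerDiam_le {n d : ℕ} (hn : 3 ≤ n) {G : SimpleGraph (Fin n)}
    (hG : steinerDiam G 3 ≤ (d : ℕ∞)) : G.Connected := by
  have : Nonempty (Fin n) := ⟨⟨0, by omega⟩⟩
  refine ⟨fun u v => ?_⟩
  obtain ⟨S, hS, hc⟩ := Finset.exists_superset_card_eq (s := {u, v}) (n := 3)
    (Finset.card_le_two.trans (by norm_num)) (by simpa using hn)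
  obtain ⟨W, hW, hconn, -⟩ := (steinerDist_le_iff _ _ _).1
    ((steinerDiam_le_iff G 3 (by norm_num) _).1 hG S hc)
  have hu : u ∈ (W : Set (Fin n)) := hW (hS (by simp))
  have hv : v ∈ (W : Set (Fin n)) := hW (hS (by simp))
  exact (hconn.preconnected ⟨u, hu⟩ ⟨v, hv⟩).map (SimpleGraph.Embedding.induce _).toHom

/-- For `d = n - 3` the condition on the Steiner `3`-diameter says that every `3`-set is avoided by a
pair of vertices whose removal leaves the graph connected. -/
theorem exists_pair_of_steinerDiam_le {n : ℕ} (hn : 3 ≤ n) {G : SimpleGraph (Fin n)}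
    (hG : steinerDiam G 3 ≤ ((n - 3 : ℕ) : ℕ∞)) (S : Finset (Fin n)) (hS : S.card = 3) :
    ∃ a b, a ∉ S ∧ b ∉ S ∧ a ≠ b ∧ (G.induce ({a, b}ᶜ : Set (Fin n))).Connected := by
  obtain ⟨W, hW, hconn, hcard⟩ := (steinerDist_le_iff _ _ _).1
    ((steinerDiam_le_iff G 3 (by norm_num) _).1 hG S hS)
  obtain ⟨U, hWU, hU, hUc⟩ := exists_connected_superset_card (connected_of_steinerDiam_le hn hG) W
    hconn (n - 2) (by omega) (by simp)
  have h2 : Uᶜ.card = 2 := by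
    rw [Finset.card_compl, Fintype.card_fin]
    omega
  obtain ⟨a, b, hab, he⟩ := Finset.card_eq_two.1 h2
  have hUe : ({a, b}ᶜ : Set (Fin n)) = U := by
    rw [← compl_compl (U : Set (Fin n)), ← Finset.coe_compl, he]
    simp
  have hSU : ∀ x ∈ S, x ∈ U := fun x hx => hWU (hW hx)
  have ha : a ∉ U := by
    rw [← Finset.mem_compl, he]
    simp
  have hb : b ∉ U := by
    rw [← Finset.mem_compl, he]
    simp
  exact ⟨a, b, fun h => ha (hSU a h), fun h => hb (hSU b h), hab, hUe ▸ hU⟩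

theorem steinerDiam_le_of_pairs {n : ℕ} (hn : 3 ≤ n) {G : SimpleGraph (Fin n)}
    (h : ∀ S : Finset (Fin n), S.card = 3 →
      ∃ a b, a ∉ S ∧ b ∉ S ∧ a ≠ b ∧ (G.induce ({a, b}ᶜ : Set (Fin n))).Connected) :
    steinerDiam G 3 ≤ ((n - 3 : ℕ) : ℕ∞) := by
  rw [steinerDiam_le_iff _ _ (by norm_num)]
  intro S hS
  obtain ⟨a, b, ha, hb, hab, hc⟩ := h S hS
  rw [steinerDist_le_iff]
  refine ⟨{a, b}ᶜ, ?_, by rwa [Finset.coe_compl, Finset.coe_pair], ?_⟩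
  · intro x hx
    simp only [Finset.coe_compl, Finset.coe_insert, Finset.coe_singleton, Set.mem_compl_iff,
      Set.mem_insert_iff, Set.mem_singleton_iff, not_or]
    exact ⟨fun h => ha (h ▸ hx), fun h => hb (h ▸ hx)⟩
  · rw [Finset.card_compl, Finset.card_pair hab, Fintype.card_fin]
    omega

open Classical in
/-- The connected graph left after removing `a` and `b` has at least `n - 3` edges, so few edges can
meet `a` or `b`. -/
theorem degree_add_degree_le {V : Type*} [Fintype V] {G : SimpleGraph V} {a b : V} (hab : a ≠ b)
    (hc : (G.induce ({a, b}ᶜ : Set V)).Connected) :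
    G.degree a + G.degree b + Fintype.card V ≤
      G.edgeFinset.card + 3 + if G.Adj a b then 1 else 0 := by
  have h1 := hc.card_vert_le_card_edgeSet_add_one
  rw [Nat.card_coe_set_eq, Set.ncard_eq_toFinset_card', Set.toFinset_compl, Finset.card_compl] at h1
  have h2 : ({a, b} : Set V).toFinset.card = 2 := by
    rw [Set.toFinset_insert, Set.toFinset_singleton, Finset.card_pair hab]
  rw [h2, Nat.card_eq_fintype_card, ← SimpleGraph.edgeFinset_card] at h1
  set I := (G.induce ({a, b}ᶜ : Set V)).edgeFinset.map
    ⟨Sym2.map Subtype.val, Sym2.map.injective Subtype.val_injective⟩ with hI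
  have hIcard : I.card = (G.induce ({a, b}ᶜ : Set V)).edgeFinset.card := Finset.card_map _
  have hIn : ∀ e ∈ I, a ∉ e ∧ b ∉ e ∧ e ∈ G.edgeFinset := by
    intro e he
    obtain ⟨f, hf, rfl⟩ := Finset.mem_map.1 he
    induction f with | _ x y =>
      obtain ⟨x, hx⟩ := x
      obtain ⟨y, hy⟩ := y
      simp at hx hy hf
      simp [hf]
      grind
  have hdisj : Disjoint I (G.incidenceFinset a ∪ G.incidenceFinset b) := by
    rw [Finset.disjoint_left]
    intro e he h
    rcases Finset.mem_union.1 h with h | h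
    · exact (hIn e he).1 ((G.mem_incidenceFinset _ _).1 h).2
    · exact (hIn e he).2.1 ((G.mem_incidenceFinset _ _).1 h).2
  have hsub : I ∪ (G.incidenceFinset a ∪ G.incidenceFinset b) ⊆ G.edgeFinset := by
    refine Finset.union_subset (fun e he => (hIn e he).2.2) (Finset.union_subset ?_ ?_) <;>
    exact G.incidenceFinset_subset _
  have hint : (G.incidenceFinset a ∩ G.incidenceFinset b).card ≤ if G.Adj a b then 1 else 0 := by
    have : G.incidenceFinset a ∩ G.incidenceFinset b ⊆ if G.Adj a b then {s(a, b)} else ∅ := by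
      intro e he
      rw [Finset.mem_inter, G.mem_incidenceFinset, G.mem_incidenceFinset] at he
      have := (Sym2.mem_and_mem_iff hab).1 ⟨he.1.2, he.2.2⟩
      subst this
      have := he.1.1
      simp_all
    refine (Finset.card_le_card this).trans ?_
    split_ifs <;> simp
  have h3 := Finset.card_le_card hsub
  rw [Finset.card_union_of_disjoint hdisj] at h3
  have h4 := Finset.card_union_add_card_inter (G.incidenceFinset a) (G.incidenceFinset b)
  rw [G.card_incidenceFinset_eq_degree, G.card_incidenceFinset_eq_degree] at h4
  omega

/-- A nonempty set of vertices closed under adjacency exhausts a connected graph. -/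
theorem mem_of_connected_of_closed {V : Type*} {G : SimpleGraph V} (hG : G.Connected) {T : Set V}
    {x : V} (hx : x ∈ T) (h : ∀ u ∈ T, ∀ v, G.Adj u v → v ∈ T) (y : V) : y ∈ T := by
  obtain ⟨p⟩ := hG.preconnected x y
  by_contra hy
  obtain ⟨d, -, hd1, hd2⟩ := p.exists_boundary_dart T hx hy
  exact hd2 (h _ hd1 _ d.adj)

/-! ### Lower bounds on the number of edges -/

open Classical in
theorem card_le_edges_add_one {n : ℕ} {G : SimpleGraph (Fin n)} (hG : G.Connected) :
    n ≤ G.edgeFinset.card + 1 := by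
  have := hG.card_vert_le_card_edgeSet_add_one
  rwa [Nat.card_eq_fintype_card, Nat.card_eq_fintype_card, ← SimpleGraph.edgeFinset_card,
    Fintype.card_fin] at this

open Classical in
/-- The edge count behind the lower bounds: every `3`-set is avoided by two vertices of small total
degree. -/
theorem exists_low_degree_pair {n : ℕ} (hn : 3 ≤ n) {G : SimpleGraph (Fin n)}
    (hG : steinerDiam G 3 ≤ ((n - 3 : ℕ) : ℕ∞)) (C : Finset (Fin n)) (hC : C.card ≤ 3) :
    ∃ a b, a ∉ C ∧ b ∉ C ∧ a ≠ b ∧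
      G.degree a + G.degree b + n ≤ G.edgeFinset.card + 3 + if G.Adj a b then 1 else 0 := by
  obtain ⟨S, hS, hc⟩ := Finset.exists_superset_card_eq (s := C) (n := 3) hC (by simpa using hn)
  obtain ⟨a, b, ha, hb, hab, hconn⟩ := exists_pair_of_steinerDiam_le hn hG S hc
  have := degree_add_degree_le hab hconn
  rw [Fintype.card_fin] at this
  exact ⟨a, b, fun h => ha (hS h), fun h => hb (hS h), hab, this⟩

open Classical in
theorem one_le_degree {n : ℕ} (hn : 2 ≤ n) {G : SimpleGraph (Fin n)} (hG : G.Connected)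
    (v : Fin n) : 1 ≤ G.degree v := by
  have : Nontrivial (Fin n) := Fin.nontrivial_iff_two_le.2 hn
  exact hG.preconnected.degree_pos_of_nontrivial v

open Classical in
/-- The number of vertices of degree `i`. -/
noncomputable def degreeCount {n : ℕ} (G : SimpleGraph (Fin n)) (i : ℕ) : ℕ :=
  (Finset.univ.filter fun v => G.degree v = i).card

open Classical in
theorem sum_degreeCount {n : ℕ} (hn : 2 ≤ n) {G : SimpleGraph (Fin n)} (hG : G.Connected)
    (h4 : ∀ v, G.degree v ≤ 4) :
    degreeCount G 1 + degreeCount G 2 + degreeCount G 3 + degreeCount G 4 = n ∧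
    degreeCount G 1 + 2 * degreeCount G 2 + 3 * degreeCount G 3 + 4 * degreeCount G 4 =
      2 * G.edgeFinset.card := by
  have h1 := one_le_degree hn hG
  rw [← G.sum_degrees_eq_twice_card_edges]
  simp only [degreeCount, Finset.card_filter, Finset.mul_sum, ← Finset.sum_add_distrib]
  constructor
  · trans ∑ _v : Fin n, 1
    · refine Finset.sum_congr rfl fun v _ => ?_
      have := h1 v
      have := h4 v
      interval_cases G.degree v <;> simp
    · simp
  · refine Finset.sum_congr rfl fun v _ => ?_
    have := h1 v
    have := h4 v
    interval_cases G.degree v <;> simp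

open Classical in
/-- In a tree, a pair avoiding all leaves has too large a total degree to be removable. -/
theorem four_le_degreeCount_one {n : ℕ} (hn : 3 ≤ n) {G : SimpleGraph (Fin n)}
    (hG : steinerDiam G 3 ≤ ((n - 3 : ℕ) : ℕ∞)) (he : G.edgeFinset.card + 1 = n) :
    4 ≤ degreeCount G 1 := by
  by_contra! hlt
  have h1 := one_le_degree (by omega) (connected_of_steinerDiam_le hn hG)
  obtain ⟨a, b, ha, hb, -, hd⟩ := exists_low_degree_pair hn hG
    (Finset.univ.filter fun v => G.degree v = 1) (by unfold degreeCount at hlt; omega)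
  simp only [Finset.mem_filter, Finset.mem_univ, true_and] at ha hb
  have := h1 a
  have := h1 b
  split_ifs at hd <;> omega

open Classical in
/-- With four leaves and at most one vertex of degree `2` a tree is excluded: choose three of the
leaves so that the fourth is not adjacent to a vertex of degree `2`. -/
theorem tree_four_leaves_false {n : ℕ} (hn : 3 ≤ n) {G : SimpleGraph (Fin n)}
    (hG : steinerDiam G 3 ≤ ((n - 3 : ℕ) : ℕ∞)) (he : G.edgeFinset.card + 1 = n)
    (hL : degreeCount G 1 = 4) (hD : degreeCount G 2 ≤ 1) : False := by
  have h1 := one_le_degree (by omega) (connected_of_steinerDiam_le hn hG)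
  unfold degreeCount at hL hD
  obtain ⟨l, hl, hl2⟩ : ∃ l, G.degree l = 1 ∧ ∀ x, G.degree x = 2 → ¬ G.Adj l x := by
    by_contra! h
    choose! f hf hadj using h
    obtain ⟨l, hl⟩ : (Finset.univ.filter fun v => G.degree v = 1).Nonempty := by
      rw [← Finset.card_pos]
      omega
    simp only [Finset.mem_filter, Finset.mem_univ, true_and] at hl
    have : (Finset.univ.filter fun v => G.degree v = 1) ⊆ G.neighborFinset (f l) := by
      intro m hm
      simp only [Finset.mem_filter, Finset.mem_univ, true_and] at hm
      have : f m = f l := Finset.card_le_one.1 hD _ (by simp [hf m hm]) _ (by simp [hf l hl])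
      rw [SimpleGraph.mem_neighborFinset, ← this]
      exact (hadj m hm).symm
    have := Finset.card_le_card this
    rw [SimpleGraph.card_neighborFinset_eq_degree, hf l hl] at this
    omega
  obtain ⟨a, b, ha, hb, hab, hd⟩ := exists_low_degree_pair hn hG
    ((Finset.univ.filter fun v => G.degree v = 1).erase l)
    (by rw [Finset.card_erase_of_mem (by simp [hl])]; omega)
  simp only [Finset.mem_filter, Finset.mem_erase, Finset.mem_univ, true_and, not_and] at ha hb
  have hda := h1 a
  have hdb := h1 b
  have hadj : G.Adj a b := by
    by_contra h
    rw [if_neg h] at hd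
    by_cases hal : a = l
    · exact absurd (hb (fun h => hab (hal.trans h.symm))) (by omega)
    · exact absurd (ha hal) (by omega)
  rw [if_pos hadj] at hd
  by_cases hal : a = l
  · subst hal
    have := hb hab.symm
    exact hl2 b (by omega) hadj
  · have hal' := ha hal
    by_cases hbl : b = l
    · subst hbl
      exact hl2 a (by omega) hadj.symm
    · have := hb hbl
      omega

open Classical in
/-- Three vertices of degree `2` that are pairwise adjacent form a component. -/
theorem exists_not_adj_of_degree_two {n : ℕ} (hn : 4 ≤ n) {G : SimpleGraph (Fin n)}
    (hG : G.Connected) (T : Finset (Fin n)) (hT : ∀ v ∈ T, G.degree v = 2) (h3 : 3 ≤ T.card) :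
    ∃ y ∈ T, ∃ z ∈ T, y ≠ z ∧ ¬ G.Adj y z := by
  by_contra! h
  obtain ⟨U, hU, hUc⟩ := Finset.exists_subset_card_eq h3
  obtain ⟨x, hx⟩ : U.Nonempty := by
    rw [← Finset.card_pos]
    omega
  have huniv : U = Finset.univ := by
    refine Finset.eq_univ_iff_forall.2 fun y =>
      mem_of_connected_of_closed hG (T := (U : Set (Fin n))) hx (fun u hu v huv => ?_) y
    have hsub : U.erase u ⊆ G.neighborFinset u := by
      intro w hw
      rw [SimpleGraph.mem_neighborFinset]
      exact h u (hU hu) w (hU (Finset.mem_of_mem_erase hw)) (Finset.ne_of_mem_erase hw).symm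
    have heq := Finset.eq_of_subset_of_card_le hsub
      (by rw [SimpleGraph.card_neighborFinset_eq_degree, hT u (hU hu), Finset.card_erase_of_mem hu,
        hUc])
    have : v ∈ U.erase u := by
      rw [heq, SimpleGraph.mem_neighborFinset]
      exact huv
    exact Finset.mem_of_mem_erase this
  rw [huniv, Finset.card_univ, Fintype.card_fin] at hUc
  omega

open Classical in
/-- At most six vertices of degree `2` contain an independent set with at least half of them: since
`n ≥ 6`, connectedness excludes triangles and `5`-cycles among them. -/
theorem exists_independent_of_degree_two {n : ℕ} (hn : 6 ≤ n) {G : SimpleGraph (Fin n)}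
    (hG : G.Connected) (D : Finset (Fin n)) (hD : ∀ v ∈ D, G.degree v = 2) (h6 : D.card ≤ 6) :
    ∃ I ⊆ D, D.card ≤ 2 * I.card ∧ ∀ x ∈ I, ∀ y ∈ I, ¬ G.Adj x y := by
  by_cases h0 : D.card = 0
  · exact ⟨∅, by simp, by omega, by simp⟩
  by_cases h2 : D.card ≤ 2
  · obtain ⟨x, hx⟩ := Finset.card_pos.1 (by omega : 0 < D.card)
    exact ⟨{x}, by simpa using hx, by simpa using h2, by simp⟩
  by_cases h4 : D.card ≤ 4
  · obtain ⟨y, hy, z, hz, hyz, hna⟩ := exists_not_adj_of_degree_two (by omega) hG D hD (by omega)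
    refine ⟨{y, z}, by grind, by rw [Finset.card_pair hyz]; omega, ?_⟩
    have hna' : ¬ G.Adj z y := fun h => hna h.symm
    simp [hna, hna']
  obtain ⟨x, hx, h3⟩ : ∃ x ∈ D, 3 ≤ ((D.erase x) \ G.neighborFinset x).card := by
    by_cases h5 : D.card = 5
    · -- some vertex of `D` has a neighbour outside `D`, hence at most one neighbour in `D`
      obtain ⟨x, hx, y, hy, hxy⟩ : ∃ x ∈ D, ∃ y ∉ D, G.Adj x y := by
        by_contra! h
        obtain ⟨x, hx⟩ := Finset.card_pos.1 (by omega : 0 < D.card)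
        have : D = Finset.univ := Finset.eq_univ_iff_forall.2 fun y =>
          mem_of_connected_of_closed hG (T := (D : Set (Fin n))) hx
            (fun u hu v huv => by
              by_contra hv
              exact h u hu v hv huv) y
        rw [this, Finset.card_univ, Fintype.card_fin] at h5
        omega
      refine ⟨x, hx, ?_⟩
      have hsub : (D.erase x) \ ((G.neighborFinset x).erase y) ⊆
          (D.erase x) \ G.neighborFinset x := by
        intro w hw
        simp only [Finset.mem_sdiff, Finset.mem_erase] at hw ⊢
        exact ⟨hw.1, fun h => hw.2 ⟨fun h' => hy (h' ▸ hw.1.2), h⟩⟩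
      have hc := Finset.le_card_sdiff ((G.neighborFinset x).erase y) (D.erase x)
      rw [Finset.card_erase_of_mem hx, Finset.card_erase_of_mem (by simpa using hxy),
        SimpleGraph.card_neighborFinset_eq_degree, hD x hx] at hc
      have := Finset.card_le_card hsub
      omega
    · obtain ⟨x, hx⟩ := Finset.card_pos.1 (by omega : 0 < D.card)
      refine ⟨x, hx, ?_⟩
      have hc := Finset.le_card_sdiff (G.neighborFinset x) (D.erase x)
      rw [Finset.card_erase_of_mem hx, SimpleGraph.card_neighborFinset_eq_degree, hD x hx] at hc
      omega
  obtain ⟨y, hy, z, hz, hyz, hna⟩ := exists_not_adj_of_degree_two (by omega) hG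
    ((D.erase x) \ G.neighborFinset x) (by grind) h3
  simp only [Finset.mem_sdiff, Finset.mem_erase, SimpleGraph.mem_neighborFinset] at hy hz
  have hna' : ¬ G.Adj z y := fun h => hna h.symm
  have hxy : ¬ G.Adj y x := fun h => hy.2 h.symm
  have hxz : ¬ G.Adj z x := fun h => hz.2 h.symm
  refine ⟨{x, y, z}, by grind, ?_, ?_⟩
  · rw [Finset.card_eq_three.2 ⟨x, y, z, hy.1.1.symm, hz.1.1.symm, hyz, rfl⟩]
    omega
  · simp [hna, hna', hxy, hxz, hy.2, hz.2]

open Classical in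
/-- In a unicyclic graph a removable pair without leaves consists of two adjacent vertices of degree
`2`, so few leaves and few vertices of degree `2` can be blocked by one `3`-set. -/
theorem unicyclic_few_leaves_false {n : ℕ} (hn : 6 ≤ n) {G : SimpleGraph (Fin n)}
    (hG : steinerDiam G 3 ≤ ((n - 3 : ℕ) : ℕ∞)) (he : G.edgeFinset.card = n)
    (hD : degreeCount G 2 ≤ 6) (h : 2 * degreeCount G 1 + degreeCount G 2 ≤ 7) : False := by
  have hconn := connected_of_steinerDiam_le (by omega) hG
  have h1 := one_le_degree (by omega) hconn
  obtain ⟨I, hID, hIc, hI⟩ := exists_independent_of_degree_two hn hconn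
    (Finset.univ.filter fun v => G.degree v = 2) (by simp) hD
  unfold degreeCount at hD h
  obtain ⟨a, b, ha, hb, hab, hd⟩ := exists_low_degree_pair (by omega) hG
    ((Finset.univ.filter fun v => G.degree v = 1) ∪
      ((Finset.univ.filter fun v => G.degree v = 2) \ I)) (by
      refine (Finset.card_union_le _ _).trans ?_
      rw [Finset.card_sdiff_of_subset hID]
      omega)
  simp only [Finset.mem_union, Finset.mem_filter, Finset.mem_sdiff, Finset.mem_univ, true_and,
    not_or, not_and, not_not] at ha hb
  have hda := h1 a
  have hdb := h1 b
  have hadj : G.Adj a b := by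
    by_contra h
    rw [if_neg h] at hd
    omega
  rw [if_pos hadj] at hd
  exact hI a (ha.2 (by omega)) b (hb.2 (by omega)) hadj

open Classical in
/-- With `n` edges no pair avoiding three leaves is removable if, apart from the four leaves, all
degrees are at least `4`: a leaf and a neighbour of degree `4` already have total degree `5`. -/
theorem unicyclic_four_leaves_false {n : ℕ} (hn : 3 ≤ n) {G : SimpleGraph (Fin n)}
    (hG : steinerDiam G 3 ≤ ((n - 3 : ℕ) : ℕ∞)) (he : G.edgeFinset.card = n)
    (hL : degreeCount G 1 = 4) (hD : ∀ v, G.degree v = 1 ∨ 4 ≤ G.degree v) : False := by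
  unfold degreeCount at hL
  obtain ⟨l, hl⟩ := Finset.card_pos.1
    (by omega : 0 < (Finset.univ.filter fun v => G.degree v = 1).card)
  obtain ⟨a, b, ha, hb, hab, hd⟩ := exists_low_degree_pair hn hG
    ((Finset.univ.filter fun v => G.degree v = 1).erase l)
    (by rw [Finset.card_erase_of_mem hl]; omega)
  simp only [Finset.mem_filter, Finset.mem_erase, Finset.mem_univ, true_and, not_and] at ha hb
  have hda := hD a
  have hdb := hD b
  -- the leaf `l` is the only one left, so `a` or `b` has degree at least `4`
  by_cases hal : a = l
  · have := hb (fun h => hab (hal.trans h.symm))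
    split_ifs at hd <;> omega
  · have := ha hal
    split_ifs at hd <;> omega

open Classical in
theorem card_le_edges_of_degree_le_two {n : ℕ} (hn : 3 ≤ n) {G : SimpleGraph (Fin n)}
    (hG : steinerDiam G 3 ≤ ((n - 3 : ℕ) : ℕ∞)) (h2 : ∀ v, G.degree v ≤ 2) :
    n ≤ G.edgeFinset.card := by
  have hconn := connected_of_steinerDiam_le hn hG
  have h1 := card_le_edges_add_one hconn
  by_contra! hlt
  obtain ⟨h3, h4⟩ := sum_degreeCount (by omega) hconn fun v => (h2 v).trans (by norm_num)
  have h5 := four_le_degreeCount_one hn hG (by omega)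
  have h6 : ∀ i, 3 ≤ i → degreeCount G i = 0 := fun i hi => by
    simp only [degreeCount, Finset.card_eq_zero, Finset.filter_eq_empty_iff]
    intro v _
    have := h2 v
    omega
  have h7 := h6 3 le_rfl
  have h8 := h6 4 (by norm_num)
  omega

open Classical in
theorem seven_le_edges {G : SimpleGraph (Fin 6)}
    (hG : steinerDiam G 3 ≤ ((6 - 3 : ℕ) : ℕ∞)) (hd : ∀ v, G.degree v ≤ 4) :
    7 ≤ G.edgeFinset.card := by
  have hconn := connected_of_steinerDiam_le (by norm_num) hG
  have h1 := card_le_edges_add_one hconn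
  by_contra! hlt
  obtain ⟨h3, h4⟩ := sum_degreeCount (by norm_num) hconn hd
  by_cases he : G.edgeFinset.card + 1 = 6
  · have h5 := four_le_degreeCount_one (by norm_num) hG he
    exact tree_four_leaves_false (by norm_num) hG he (by omega) (by omega)
  · have he' : G.edgeFinset.card = 6 := by omega
    by_cases hL : degreeCount G 1 ≤ 3
    · exact unicyclic_few_leaves_false le_rfl hG he' (by omega) (by omega)
    · have h5 : degreeCount G 2 = 0 := by omega
      have h6 : degreeCount G 3 = 0 := by omega
      simp only [degreeCount, Finset.card_eq_zero, Finset.filter_eq_empty_iff] at h5 h6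
      refine unicyclic_four_leaves_false (by norm_num) hG he' (by omega) fun v => ?_
      have := h5 (Finset.mem_univ v)
      have := h6 (Finset.mem_univ v)
      have := one_le_degree (by norm_num) hconn v
      omega

open Classical in
theorem eight_le_edges {G : SimpleGraph (Fin 7)}
    (hG : steinerDiam G 3 ≤ ((7 - 3 : ℕ) : ℕ∞)) (hd : ∀ v, G.degree v ≤ 3)
    (hd' : ∃ v, G.degree v = 3) : 8 ≤ G.edgeFinset.card := by
  have hconn := connected_of_steinerDiam_le (by norm_num) hG
  have h1 := card_le_edges_add_one hconn
  by_contra! hlt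
  obtain ⟨h3, h4⟩ := sum_degreeCount (by norm_num) hconn fun v => (hd v).trans (by norm_num)
  have h5 : degreeCount G 4 = 0 := by
    simp only [degreeCount, Finset.card_eq_zero, Finset.filter_eq_empty_iff]
    intro v _
    have := hd v
    omega
  have h6 : 0 < degreeCount G 3 := by
    obtain ⟨v, hv⟩ := hd'
    exact Finset.card_pos.2 ⟨v, by simpa using hv⟩
  by_cases he : G.edgeFinset.card + 1 = 7
  · have h5 := four_le_degreeCount_one (by norm_num) hG he
    exact tree_four_leaves_false (by norm_num) hG he (by omega) (by omega)
  · exact unicyclic_few_leaves_false (by norm_num) hG (by omega) (by omega) (by omega)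

open Classical in
/-- On five vertices all `3`-sets are connected, so a vertex has at most one non-neighbour; by parity
some vertex has none. -/
theorem five_vertices {G : SimpleGraph (Fin 5)}
    (hG : steinerDiam G 3 ≤ ((5 - 3 : ℕ) : ℕ∞)) :
    8 ≤ G.edgeFinset.card ∧ ∃ v, G.degree v = 4 := by
  have hdeg : ∀ v, 3 ≤ G.degree v := by
    intro v
    by_contra! hlt
    have hc : 2 ≤ ((Finset.univ.erase v) \ G.neighborFinset v).card := by
      have hc := Finset.le_card_sdiff (G.neighborFinset v) (Finset.univ.erase v)
      rw [Finset.card_erase_of_mem (Finset.mem_univ _), SimpleGraph.card_neighborFinset_eq_degree,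
        Finset.card_univ, Fintype.card_fin] at hc
      omega
    obtain ⟨T, hT, hTc⟩ := Finset.exists_subset_card_eq hc
    have hvT : v ∉ T := fun h => by simpa using hT h
    obtain ⟨W, hW, hconn, hWc⟩ := (steinerDist_le_iff _ _ _).1
      ((steinerDiam_le_iff G 3 (by norm_num) _).1 hG (insert v T)
        (by rw [Finset.card_insert_of_notMem hvT, hTc]))
    have hWe : insert v T = W := Finset.eq_of_subset_of_card_le (by exact_mod_cast hW)
      (by rw [Finset.card_insert_of_notMem hvT, hTc]; exact hWc)
    have hvW : v ∈ (W : Set (Fin 5)) := by simp [← hWe]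
    obtain ⟨t, ht⟩ := Finset.card_pos.1 (by omega : 0 < T.card)
    have htW : t ∈ (W : Set (Fin 5)) := by simp [← hWe, ht]
    have : Nontrivial (W : Set (Fin 5)) :=
      ⟨⟨v, hvW⟩, ⟨t, htW⟩, fun h => hvT (by simp at h; exact h ▸ ht)⟩
    obtain ⟨⟨u, huW⟩, hu⟩ := hconn.preconnected.exists_adj_of_nontrivial ⟨v, hvW⟩
    have huv : G.Adj v u := hu
    have hu' : u ∈ insert v T := by rw [hWe]; exact huW
    rcases Finset.mem_insert.1 hu' with h | h
    · exact G.loopless.irrefl v (h ▸ huv)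
    · have := hT h
      simp [huv] at this
  have hsum := G.sum_degrees_eq_twice_card_edges
  have h15 : ∑ _v : Fin 5, 3 ≤ ∑ v, G.degree v := Finset.sum_le_sum fun v _ => hdeg v
  simp only [Finset.sum_const, Finset.card_univ, Fintype.card_fin, smul_eq_mul] at h15
  refine ⟨by omega, ?_⟩
  by_contra! h
  have : ∀ v, G.degree v = 3 := fun v => by
    have h1 := G.degree_lt_card_verts v
    have h2 := h v
    have h3 := hdeg v
    rw [Fintype.card_fin] at h1
    omega
  simp [this] at hsum
  omega

/-! ### Extremal graphs -/

/-- The graph on `Fin n` joining every `i ≠ 0` to `p i`. If `p i < i` for `i ≠ 0` it is a tree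
rooted at `0`, with `p i` the parent of `i`. -/
def parentGraph (n : ℕ) (p : ℕ → ℕ) : SimpleGraph (Fin n) :=
  SimpleGraph.fromRel fun i j => (i : ℕ) ≠ 0 ∧ p i = j

theorem parentGraph_edges_le {n : ℕ} {p : ℕ → ℕ} (hp : ∀ i, i ≠ 0 → p i < i) :
    (parentGraph n p).edgeSet.encard ≤ ((n - 1 : ℕ) : ℕ∞) := by
  -- the `min` equals `p i` at `i ≠ 0`, and keeps the map defined at `0`
  have hsub : (parentGraph n p).edgeSet ⊆ (fun i : Fin n => s(i, ⟨min (p i) i, by omega⟩)) ''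
      ((Finset.univ.filter fun i : Fin n => (i : ℕ) ≠ 0 : Finset (Fin n)) : Set (Fin n)) := by
    intro e he
    induction e with | _ x y =>
      obtain ⟨-, ⟨h1, h2⟩ | ⟨h1, h2⟩⟩ := he
      · refine ⟨x, by simpa using h1, ?_⟩
        have : min (p x) x = y := by
          change p x = y at h2
          have := hp x h1
          omega
        simp [this]
      · refine ⟨y, by simpa using h1, ?_⟩
        have : min (p y) y = x := by
          change p y = x at h2
          have := hp y h1
          omega
        simp [this]
  refine (Set.encard_le_encard hsub).trans ((Set.encard_image_le _ _).trans ?_)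
  rw [Set.encard_coe_eq_coe_finsetCard]
  norm_cast
  rcases n with _ | n
  · exact (Finset.card_le_univ _).trans (by simp)
  · have : (Finset.univ.filter fun i : Fin (n + 1) => (i : ℕ) ≠ 0) = Finset.univ.erase 0 := by
      ext i
      simp only [Finset.mem_filter, Finset.mem_univ, true_and, Finset.mem_erase, and_true, ne_eq,
        Fin.ext_iff, Fin.val_zero]
    rw [this, Finset.card_erase_of_mem (Finset.mem_univ _), Finset.card_univ, Fintype.card_fin]

/-- A tree with at least five leaves (the elements of `T`) has Steiner `3`-diameter at most `n - 3`:
two of the leaves avoid any given `3`-set. -/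
theorem parentGraph_steinerDiam_le {n : ℕ} (hn : 3 ≤ n) {p : ℕ → ℕ} (hp : ∀ i, i ≠ 0 → p i < i)
    (T : Finset ℕ) (hT : 5 ≤ T.card) (hT1 : ∀ t ∈ T, 1 ≤ t ∧ t < n)
    (hT2 : ∀ t ∈ T, ∀ i, i ≠ 0 → i < n → p i ≠ t) :
    steinerDiam (parentGraph n p) 3 ≤ ((n - 3 : ℕ) : ℕ∞) := by
  refine steinerDiam_le_of_pairs hn fun S hS => ?_
  have hc : 1 < (T \ S.map Fin.valEmbedding).card := by
    have := Finset.le_card_sdiff (S.map Fin.valEmbedding) T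
    rw [Finset.card_map] at this
    omega
  obtain ⟨a, ha, b, hb, hab⟩ := Finset.one_lt_card.1 hc
  rw [Finset.mem_sdiff] at ha hb
  have ha1 := hT1 a ha.1
  have hb1 := hT1 b hb.1
  refine ⟨⟨a, ha1.2⟩, ⟨b, hb1.2⟩, fun h => ha.2 (Finset.mem_map.2 ⟨_, h, rfl⟩),
    fun h => hb.2 (Finset.mem_map.2 ⟨_, h, rfl⟩), by simpa using hab, ?_⟩
  refine induce_connected_of_rank (r := ⟨0, by omega⟩) (by simp; omega) (fun v => (v : ℕ)) ?_
  rintro ⟨v, hv⟩ - hv0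
  have hv0' : v ≠ 0 := by simpa using hv0
  have hlt := hp v hv0'
  refine ⟨⟨p v, by omega⟩, ?_, ?_, hlt⟩
  · have h1 := hT2 a ha.1 v hv0' hv
    have h2 := hT2 b hb.1 v hv0' hv
    simp [h1, h2]
  · exact ⟨by simp; omega, Or.inr ⟨hv0', rfl⟩⟩

open Classical in
theorem parentGraph_maxDegree {n l : ℕ} {p : ℕ → ℕ} (hl : 3 ≤ l) (hln : l < n)
    (hp0 : ∀ i, i ≠ 0 → (p i = 0 ↔ i ≤ l))
    (F : ℕ → Finset ℕ) (hF : ∀ i, (F i).card ≤ 2) (hF' : ∀ i, i ≠ 0 → p i ≠ 0 → i ∈ F (p i)) :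
    (parentGraph n p).maxDegree = l := by
  have : Nonempty (Fin n) := ⟨⟨0, by omega⟩⟩
  have hroot : (parentGraph n p).degree ⟨0, by omega⟩ = l := by
    have : ((parentGraph n p).neighborFinset ⟨0, by omega⟩).map Fin.valEmbedding =
        Finset.Icc 1 l := by
      ext i
      simp only [Finset.mem_map, SimpleGraph.mem_neighborFinset, Finset.mem_Icc]
      constructor
      · rintro ⟨i, ⟨h1, ⟨h2, h3⟩ | ⟨h2, h3⟩⟩, rfl⟩
        · simp at h2
        · have := (hp0 i h2).1 h3
          simp only [Fin.valEmbedding_apply]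
          omega
      · rintro ⟨h1, h2⟩
        refine ⟨⟨i, by omega⟩, ⟨by simp; omega, Or.inr ⟨by simp; omega, ?_⟩⟩, rfl⟩
        exact (hp0 i (by omega)).2 h2
    rw [← SimpleGraph.card_neighborFinset_eq_degree, ← Finset.card_map Fin.valEmbedding, this]
    simp
  refine (maxDegree_eq_iff _ _).2 ⟨fun v => ?_, _, hroot⟩
  by_cases hv : (v : ℕ) = 0
  · have : v = ⟨0, by omega⟩ := Fin.ext hv
    rw [this, hroot]
  · have hsub : ((parentGraph n p).neighborFinset v).map Fin.valEmbedding ⊆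
        insert (p v) (F v) := by
      intro i
      simp only [Finset.mem_map, SimpleGraph.mem_neighborFinset, Finset.mem_insert]
      rintro ⟨i, ⟨h1, ⟨h2, h3⟩ | ⟨h2, h3⟩⟩, rfl⟩
      · exact Or.inl h3.symm
      · right
        have := hF' i h2 (by omega)
        rwa [h3] at this
    have h1 := Finset.card_le_card hsub
    rw [Finset.card_map, SimpleGraph.card_neighborFinset_eq_degree] at h1
    have h2 := Finset.card_insert_le (p v) (F v)
    have h3 := hF v
    omega

/-- The tree in which `0` has the children `1, …, l` and a path leaves the star at `l`. -/
def broomParent (l i : ℕ) : ℕ := if i ≤ l then 0 else i - 1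

/-- A tree of maximum degree `4` with five leaves: the vertices `0` and `4` branch. -/
def fourParent (i : ℕ) : ℕ := if i ≤ 4 then 0 else if i ≤ 6 then 4 else i - 1

/-- A tree of maximum degree `3` with five leaves: the vertices `0`, `3` and `5` branch. -/
def threeParent (i : ℕ) : ℕ := if i ≤ 3 then 0 else if i ≤ 5 then 3 else if i ≤ 7 then 5 else i - 1

theorem minSteinerSize_le {k n l d : ℕ} {m : ℕ∞} (G : SimpleGraph (Fin n))
    (hG : G ∈ steinerFamily k n l d) (hm : G.edgeSet.encard ≤ m) : minSteinerSize k n l d ≤ m :=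
  (iInf₂_le G hG).trans hm

theorem le_five_card {m : ℕ} {a b c d : ℕ} (h : [a, b, c, d, m].Nodup) :
    5 ≤ ({a, b, c, d, m} : Finset ℕ).card := by
  have := List.toFinset_card_of_nodup h
  simpa using this.ge

theorem minSteinerSize_le_of_five_le {n l : ℕ} (hl : 5 ≤ l) (hln : l ≤ n - 1) (hn : 6 ≤ n) :
    minSteinerSize 3 n l (n - 3) ≤ ((n - 1 : ℕ) : ℕ∞) := by
  have hp : ∀ i, i ≠ 0 → broomParent l i < i := fun i hi => by
    unfold broomParent
    split_ifs <;> omega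
  refine minSteinerSize_le (parentGraph n (broomParent l)) ⟨?_, ?_⟩ (parentGraph_edges_le hp)
  · refine parentGraph_maxDegree (by omega) (by omega) ?_ (fun i => {i + 1}) (by simp) ?_ <;>
    · intro i hi
      unfold broomParent
      split_ifs <;> (try simp) <;> omega
  · refine parentGraph_steinerDiam_le (by omega) hp {1, 2, 3, 4, n - 1}
      (le_five_card (by simp; omega)) (by simp; omega) ?_
    intro t ht i hi hin
    simp only [Finset.mem_insert, Finset.mem_singleton] at ht
    unfold broomParent
    split_ifs <;> omega

theorem minSteinerSize_four_le {n : ℕ} (hn : 7 ≤ n) :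
    minSteinerSize 3 n 4 (n - 3) ≤ ((n - 1 : ℕ) : ℕ∞) := by
  have hp : ∀ i, i ≠ 0 → fourParent i < i := fun i hi => by
    unfold fourParent
    split_ifs <;> omega
  refine minSteinerSize_le (parentGraph n fourParent) ⟨?_, ?_⟩ (parentGraph_edges_le hp)
  · refine parentGraph_maxDegree (by omega) (by omega) ?_
      (fun i => if i = 4 then {5, 6} else {i + 1}) (fun i => by split_ifs <;> simp) ?_ <;>
    · intro i hi
      unfold fourParent
      split_ifs <;> (try simp) <;> omega
  · refine parentGraph_steinerDiam_le (by omega) hp {1, 2, 3, 5, n - 1}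
      (le_five_card (by simp; omega)) (by simp; omega) ?_
    intro t ht i hi hin
    simp only [Finset.mem_insert, Finset.mem_singleton] at ht
    unfold fourParent
    split_ifs <;> omega

theorem minSteinerSize_three_le {n : ℕ} (hn : 8 ≤ n) :
    minSteinerSize 3 n 3 (n - 3) ≤ ((n - 1 : ℕ) : ℕ∞) := by
  have hp : ∀ i, i ≠ 0 → threeParent i < i := fun i hi => by
    unfold threeParent
    split_ifs <;> omega
  refine minSteinerSize_le (parentGraph n threeParent) ⟨?_, ?_⟩ (parentGraph_edges_le hp)
  · refine parentGraph_maxDegree (by omega) (by omega) ?_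
      (fun i => if i = 3 then {4, 5} else if i = 5 then {6, 7} else {i + 1})
      (fun i => by split_ifs <;> simp) ?_ <;>
    · intro i hi
      unfold threeParent
      split_ifs <;> (try simp) <;> omega
  · refine parentGraph_steinerDiam_le (by omega) hp {1, 2, 4, 6, n - 1}
      (le_five_card (by simp; omega)) (by simp; omega) ?_
    intro t ht i hi hin
    simp only [Finset.mem_insert, Finset.mem_singleton] at ht
    unfold threeParent
    split_ifs <;> omega

open Classical in
theorem card_edgeFinset_le_iff {n : ℕ} (G : SimpleGraph (Fin n)) (m : ℕ) :
    G.edgeSet.encard ≤ (m : ℕ∞) ↔ G.edgeFinset.card ≤ m := by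
  rw [← SimpleGraph.coe_edgeFinset, Set.encard_coe_eq_coe_finsetCard]
  norm_cast

theorem cycleGraph_steinerDiam_le {m : ℕ} :
    steinerDiam (SimpleGraph.cycleGraph (m + 7)) 3 ≤ ((m + 7 - 3 : ℕ) : ℕ∞) := by
  classical
  refine steinerDiam_le_of_pairs (by omega) fun S hS => ?_
  -- at most six vertices `a` have `a ∈ S` or `a + 1 ∈ S`
  obtain ⟨a, ha⟩ : ∃ a, a ∉ S ∪ S.image (· - 1) := by
    by_contra! h
    have h1 := Finset.card_union_le S (S.image (· - 1))
    rw [Finset.eq_univ_iff_forall.2 h, Finset.card_univ, Fintype.card_fin] at h1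
    have h2 : (S.image (· - 1)).card ≤ S.card := Finset.card_image_le
    omega
  simp only [Finset.mem_union, Finset.mem_image, not_or, not_exists, not_and] at ha
  refine ⟨a, a + 1, ha.1, fun h => ha.2 _ h (by abel), by simp, ?_⟩
  have hval : ∀ w : Fin (m + 7), w ≠ 0 → ((w - 1 : Fin (m + 7)) : ℕ) = w - 1 := fun w hw =>
    Fin.val_sub_one_of_ne_zero hw
  have h1 : ((1 : Fin (m + 7)) : ℕ) = 1 := rfl
  have h2 : ((2 : Fin (m + 7)) : ℕ) = 2 := rfl
  have h01 : (1 : Fin (m + 7)) ≠ 0 := by simp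
  have h02 : (2 : Fin (m + 7)) ≠ 0 := fun h => by
    have := congrArg Fin.val h
    rw [h2] at this
    exact absurd this (by norm_num)
  have h12 : (2 : Fin (m + 7)) ≠ 1 := fun h => by
    have := congrArg Fin.val h
    rw [h2, h1] at this
    exact absurd this (by norm_num)
  refine induce_connected_of_rank (r := a + 2) ?_ (fun v => ((v - a : Fin (m + 7)) : ℕ)) ?_
  · simp [h02, h12]
  intro v hv hvr
  simp only [Set.mem_compl_iff, Set.mem_insert_iff, Set.mem_singleton_iff, not_or] at hv
  have hv0 : v - a ≠ 0 := sub_ne_zero.2 hv.1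
  refine ⟨v - 1, ?_, ?_, ?_⟩
  · simp only [Set.mem_compl_iff, Set.mem_insert_iff, Set.mem_singleton_iff, not_or]
    refine ⟨fun h => hv.2 (sub_eq_iff_eq_add.1 h), fun h => hvr ?_⟩
    rw [sub_eq_iff_eq_add.1 h, add_assoc]
    rfl
  · rw [SimpleGraph.cycleGraph_adj]
    right
    abel
  · have h3 : v - 1 - a = v - a - 1 := by abel
    have h4 : ((v - a : Fin (m + 7)) : ℕ) ≠ 0 := fun h => hv0 (Fin.ext h)
    rw [h3, hval _ hv0]
    omega

theorem minSteinerSize_two_le {n : ℕ} (hn : 7 ≤ n) :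
    minSteinerSize 3 n 2 (n - 3) ≤ (n : ℕ∞) := by
  classical
  obtain ⟨m, rfl⟩ := Nat.exists_eq_add_of_le' hn
  have hdeg : ∀ v, (SimpleGraph.cycleGraph (m + 7)).degree v = 2 := fun v => by
    rw [← SimpleGraph.cycleGraph_degree_three_le (n := m + 4) (v := v)]
  refine minSteinerSize_le (SimpleGraph.cycleGraph (m + 7)) ⟨?_, cycleGraph_steinerDiam_le⟩ ?_
  · rw [maxDegree_eq_iff]
    refine ⟨fun v => ?_, 0, ?_⟩
    · apply le_of_eq
      convert hdeg v
    · convert hdeg 0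
  · rw [card_edgeFinset_le_iff]
    have := (SimpleGraph.cycleGraph (m + 7)).sum_degrees_eq_twice_card_edges
    simp only [hdeg, Finset.sum_const, Finset.card_univ, Fintype.card_fin, smul_eq_mul] at this
    have h2 : (SimpleGraph.cycleGraph (m + 7)).edgeFinset.card = m + 7 := by omega
    apply le_of_eq
    convert h2

/-- In the graph with edge set `E`, some vertex `r` outside `{a, b}` reaches every other vertex
outside `{a, b}` by a path of length at most `2` that avoids `a` and `b`. -/
def HasCentre {n : ℕ} (E : Finset (Sym2 (Fin n))) (a b : Fin n) : Prop :=
  ∃ r, r ≠ a ∧ r ≠ b ∧ ∀ v, v = a ∨ v = b ∨ v = r ∨ s(r, v) ∈ E ∨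
    ∃ u, u ≠ a ∧ u ≠ b ∧ s(r, u) ∈ E ∧ s(u, v) ∈ E

instance {n : ℕ} (E : Finset (Sym2 (Fin n))) (a b : Fin n) : Decidable (HasCentre E a b) := by
  unfold HasCentre
  infer_instance

/-- A criterion for the upper bound that can be checked by evaluation on a small graph given by its
set `E` of edges. -/
theorem minSteinerSize_le_card_of_edges {n l m : ℕ} (hn : 3 ≤ n) (E : Finset (Sym2 (Fin n)))
    (hm : E.card ≤ m)
    (hle : ∀ v, (Finset.univ.filter fun w => s(v, w) ∈ E ∧ v ≠ w).card ≤ l)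
    (hl : ∃ v, (Finset.univ.filter fun w => s(v, w) ∈ E ∧ v ≠ w).card = l)
    (h : ∀ S ∈ (Finset.univ : Finset (Fin n)).powersetCard 3, ∃ a, a ∉ S ∧ ∃ b, b ∉ S ∧ a ≠ b ∧
      HasCentre E a b) :
    minSteinerSize 3 n l (n - 3) ≤ (m : ℕ∞) := by
  classical
  let G := SimpleGraph.fromEdgeSet (E : Set (Sym2 (Fin n)))
  have hdeg : ∀ v, G.degree v = (Finset.univ.filter fun w => s(v, w) ∈ E ∧ v ≠ w).card := fun v => by
    rw [← SimpleGraph.card_neighborFinset_eq_degree]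
    congr 1
    ext w
    simp [G]
  have : Nonempty (Fin n) := ⟨⟨0, by omega⟩⟩
  refine minSteinerSize_le G ⟨?_, steinerDiam_le_of_pairs hn fun S hS => ?_⟩ ?_
  · rw [maxDegree_eq_iff]
    refine ⟨fun v => ?_, hl.choose, ?_⟩
    · refine le_trans (le_of_eq ?_) (hle v)
      convert hdeg v
    · convert (hdeg _).trans hl.choose_spec
  · obtain ⟨a, ha, b, hb, hab, r, hra, hrb, hr⟩ := h S (by simp [hS])
    refine ⟨a, b, ha, hb, hab, induce_connected_of_rank (r := r) (by simp [hra, hrb])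
      (fun v => if v = r then 0 else if s(r, v) ∈ E then 1 else 2) fun v hv hvr => ?_⟩
    simp only [Set.mem_compl_iff, Set.mem_insert_iff, Set.mem_singleton_iff, not_or] at hv ⊢
    by_cases hrv : s(r, v) ∈ E
    · refine ⟨r, ⟨hra, hrb⟩, ?_, by simp [hvr, hrv]⟩
      simp [G, hrv, Ne.symm hvr]
    · rcases hr v with h | h | h | h | ⟨u, hua, hub, hru, huv⟩
      · exact absurd h hv.1
      · exact absurd h hv.2
      · exact absurd h hvr
      · exact absurd h hrv
      · have hne : u ≠ v := fun h => hrv (h ▸ hru)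
        refine ⟨u, ⟨hua, hub⟩, by simp [G, huv, hne], ?_⟩
        simp only [hvr, hrv, hru, if_false, if_true]
        split_ifs <;> norm_num
  · refine le_trans ?_ (Nat.cast_le.2 hm)
    rw [← Set.encard_coe_eq_coe_finsetCard]
    refine Set.encard_le_encard ?_
    rw [SimpleGraph.edgeSet_fromEdgeSet]
    exact Set.sdiff_subset

theorem minSteinerSize_five_four_le : minSteinerSize 3 5 4 (5 - 3) ≤ ((8 : ℕ) : ℕ∞) :=
  minSteinerSize_le_card_of_edges (by norm_num)
    {s(0, 1), s(0, 2), s(0, 3), s(0, 4), s(1, 2), s(1, 3), s(2, 4), s(3, 4)}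
    (by decide) (by decide +kernel) (by decide +kernel) (by decide +kernel)

theorem minSteinerSize_six_three_le : minSteinerSize 3 6 3 (6 - 3) ≤ ((7 : ℕ) : ℕ∞) :=
  minSteinerSize_le_card_of_edges (by norm_num)
    {s(0, 1), s(0, 2), s(0, 3), s(1, 4), s(1, 5), s(2, 4), s(3, 5)}
    (by decide) (by decide +kernel) (by decide +kernel) (by decide +kernel)

theorem minSteinerSize_six_four_le : minSteinerSize 3 6 4 (6 - 3) ≤ ((7 : ℕ) : ℕ∞) :=
  minSteinerSize_le_card_of_edges (by norm_num)
    {s(0, 1), s(0, 2), s(0, 3), s(0, 4), s(1, 5), s(2, 5), s(3, 5)}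
    (by decide) (by decide +kernel) (by decide +kernel) (by decide +kernel)

theorem minSteinerSize_seven_three_le : minSteinerSize 3 7 3 (7 - 3) ≤ ((8 : ℕ) : ℕ∞) :=
  minSteinerSize_le_card_of_edges (by norm_num)
    {s(0, 1), s(0, 2), s(0, 3), s(1, 2), s(1, 4), s(3, 5), s(4, 5), s(5, 6)}
    (by decide) (by decide +kernel) (by decide +kernel) (by decide +kernel)

/-! ### The minimum sizes -/

open Classical in
theorem le_minSteinerSize {n l d m : ℕ} (hn : 0 < n)
    (h : ∀ G : SimpleGraph (Fin n), steinerDiam G 3 ≤ (d : ℕ∞) → (∀ v, G.degree v ≤ l) →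
      (∃ v, G.degree v = l) → m ≤ G.edgeFinset.card) :
    (m : ℕ∞) ≤ minSteinerSize 3 n l d := by
  have : Nonempty (Fin n) := ⟨⟨0, hn⟩⟩
  refine le_iInf₂ fun G hG => ?_
  have hd := (maxDegree_eq_iff G l).1 hG.1
  rw [← SimpleGraph.coe_edgeFinset, Set.encard_coe_eq_coe_finsetCard]
  exact_mod_cast h G hG.2 hd.1 hd.2

open Classical in
theorem minSteinerSize_eq_top {n l d : ℕ} (hn : 0 < n)
    (h : ∀ G : SimpleGraph (Fin n), steinerDiam G 3 ≤ (d : ℕ∞) → (∀ v, G.degree v ≤ l) →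
      (∃ v, G.degree v = l) → False) : minSteinerSize 3 n l d = ⊤ := by
  rw [eq_top_iff]
  have : Nonempty (Fin n) := ⟨⟨0, hn⟩⟩
  refine le_iInf₂ fun G hG => ?_
  have hd := (maxDegree_eq_iff G l).1 hG.1
  exact (h G hG.2 hd.1 hd.2).elim

theorem pred_le_minSteinerSize {n l : ℕ} (hn : 3 ≤ n) :
    ((n - 1 : ℕ) : ℕ∞) ≤ minSteinerSize 3 n l (n - 3) := by
  refine le_minSteinerSize (by omega) fun G hG _ _ => ?_
  have := card_le_edges_add_one (connected_of_steinerDiam_le hn hG)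
  omega

theorem minSteinerSize_five_eq_top {l : ℕ} (hl : l ≤ 3) : minSteinerSize 3 5 l (5 - 3) = ⊤ := by
  refine minSteinerSize_eq_top (by norm_num) fun G hG hd _ => ?_
  obtain ⟨v, hv⟩ := (five_vertices hG).2
  have := hd v
  omega

theorem minSteinerSize_six_two : minSteinerSize 3 6 2 (6 - 3) = ⊤ := by
  classical
  refine minSteinerSize_eq_top (by norm_num) fun G hG hd _ => ?_
  have h1 := seven_le_edges hG fun v => (hd v).trans (by norm_num)
  have h2 := G.sum_degrees_eq_twice_card_edges
  have h3 : ∑ v, G.degree v ≤ ∑ _v : Fin 6, 2 := Finset.sum_le_sum fun v _ => hd v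
  simp only [Finset.sum_const, Finset.card_univ, Fintype.card_fin, smul_eq_mul] at h3
  omega

theorem theorem4p2 :
    (∀ n : ℕ, 5 ≤ n →
      (n = 5 ∨ n = 6 → minSteinerSize 3 n 2 (n - 3) = ⊤) ∧
      (7 ≤ n → minSteinerSize 3 n 2 (n - 3) = (n : ℕ∞))) ∧
    (∀ n : ℕ, 5 ≤ n →
      (n = 5 → minSteinerSize 3 n 3 (n - 3) = ⊤) ∧
      (n = 6 ∨ n = 7 → minSteinerSize 3 n 3 (n - 3) = ((n + 1 : ℕ) : ℕ∞)) ∧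
      (8 ≤ n → minSteinerSize 3 n 3 (n - 3) = ((n - 1 : ℕ) : ℕ∞))) ∧
    (∀ n : ℕ, 5 ≤ n →
      (n = 5 → minSteinerSize 3 n 4 (n - 3) = ((n.choose 2 - 2 : ℕ) : ℕ∞)) ∧
      (n = 6 → minSteinerSize 3 n 4 (n - 3) = ((n + 1 : ℕ) : ℕ∞)) ∧
      (7 ≤ n → minSteinerSize 3 n 4 (n - 3) = ((n - 1 : ℕ) : ℕ∞))) ∧
    (∀ n l : ℕ, 6 ≤ n → 5 ≤ l → l ≤ n - 1 →
      minSteinerSize 3 n l (n - 3) = ((n - 1 : ℕ) : ℕ∞)) := by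
  refine ⟨fun n hn => ⟨?_, fun h => ?_⟩, fun n hn => ⟨?_, ?_, fun h => ?_⟩,
    fun n hn => ⟨?_, ?_, fun h => ?_⟩, fun n l hn hl hln => ?_⟩
  · rintro (rfl | rfl)
    · exact minSteinerSize_five_eq_top (by norm_num)
    · exact minSteinerSize_six_two
  · exact (minSteinerSize_two_le h).antisymm <| le_minSteinerSize (by omega) fun G hG hd _ =>
      card_le_edges_of_degree_le_two (by omega) hG hd
  · rintro rfl
    exact minSteinerSize_five_eq_top le_rfl
  · rintro (rfl | rfl)
    · exact minSteinerSize_six_three_le.antisymm <| le_minSteinerSize (by norm_num) fun G hG hd _ =>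
        seven_le_edges hG fun v => (hd v).trans (by norm_num)
    · exact minSteinerSize_seven_three_le.antisymm <| le_minSteinerSize (by norm_num)
        fun G hG hd hd' => eight_le_edges hG hd hd'
  · exact (minSteinerSize_three_le h).antisymm (pred_le_minSteinerSize (by omega))
  · rintro rfl
    exact minSteinerSize_five_four_le.antisymm <| le_minSteinerSize (by norm_num) fun G hG _ _ =>
      (five_vertices hG).1
  · rintro rfl
    exact minSteinerSize_six_four_le.antisymm <| le_minSteinerSize (by norm_num) fun G hG hd _ =>
      seven_le_edges hG hd
  · exact (minSteinerSize_four_le h).antisymm (pred_le_minSteinerSize (by omega))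
  · exact (minSteinerSize_le_of_five_le hl hln hn).antisymm (pred_le_minSteinerSize (by omega))
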